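/- Let $n$ be a positive odd integer and let $q$ be an indeterminate. Write $(a;q)_k=\prod_{i=0}^{k-1}(1-aq^i)$ (so $(a;q)_0=1$), $[m]=1+q+\cdots+q^{m-1}$, and let $\Phi_n(q)$ be the $n$-th cyclotomic polynomial. For $k\ge 0$ put $$c_q(k)=(-1)^k q^{k^2}[4k+1]\frac{(q;q^2)_k^3}{(q^2;q^2)_k^3}.$$ Then $$\sum_{k=0}^{n-1}\sum_{j=0}^{k}c_q(j)\,c_q(k-j)\equiv q^{(n-1)^2/2}[n]^2 \pmod{[n]\Phi_n(q)^3}.$$ Here, for rational functions $A,B\in\mathbb{Q}(q)$ and a polynomial $P\in\mathbb{Q}[q]$, $A\equiv B\pmod P$ means that $P$ divides the numerator of $A-B$ written in lowest terms. -/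

import Mathlib

open Polynomial

/-- The q-shifted factorial `(a;q)_k = (1 - a)(1 - aq)⋯(1 - aq^(k-1))`, with `(a;q)_0 = 1`. -/
def qPoch {R : Type*} [CommRing R] (a q : R) (k : ℕ) : R :=
  ∏ i ∈ Finset.range k, (1 - a * q ^ i)

/-- The q-integer `[m] = 1 + q + ⋯ + q^(m-1)`. -/
def qInt {R : Type*} [CommRing R] (q : R) (m : ℕ) : R :=
  ∑ i ∈ Finset.range m, q ^ i

/-- `c_q(k) = (-1)^k q^(k^2) [4k+1] (q;q^2)_k^3 / (q^2;q^2)_k^3`. -/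
def cTerm {K : Type*} [Field K] (q : K) (k : ℕ) : K :=
  (-1) ^ k * q ^ (k ^ 2) * qInt q (4 * k + 1) *
    (qPoch q (q ^ 2) k ^ 3 / qPoch (q ^ 2) (q ^ 2) k ^ 3)

/-- Congruence of rational functions in an indeterminate modulo a polynomial `P`: when
`A - B` is written in lowest terms, `P` divides its numerator. -/
def QCongr {K : Type*} [Field K] (P : K[X]) (A B : RatFunc K) : Prop :=
  P ∣ (A - B).num

/-! Write `c` for `cTerm` and n = 2m+1. The double sum is ∑ c(i) c(j) over i + j < n. Since [n] is
the product of the Φ_d with 1 ≠ d ∣ n, and distinct cyclotomic polynomials are coprime, it suffices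
to work modulo Φ_n^4 and modulo each other Φ_d.

Modulo Φ_n^4, split at m: the sum is the square of S = ∑_{k ≤ m} c(k) plus twice the tail with one
index above m (`sum_convolution_split`). Modulo Φ_n^3, S is (-1)^m q^(m²) [n]
(`exists_sum_cTerm_half`); as Φ_n ∣ [n], squaring gives the main term modulo Φ_n^4. In the tail,
c(m+1+r) contains (1 - q^n)^3. At a primitive n-th root of unity, the remaining cofactor is
antisymmetric under r ↦ m-1-r while its companion partial sum of `c` is symmetric, so the tail gains
a fourth factor Φ_n (`sum_tailTerm_mul_eq_zero`).

The congruence for S comes from a deformation: the cubed factorials become products with parameters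
a, 1/a, 1, polynomial in x = a + 1/a. At a = q^n the sum is evaluated exactly by a terminating
very-well-poised summation (`wp_sum`). At a root of unity the terms cancel under k ↦ m-k for every
admissible x, so the whole polynomial is divisible by Φ_n. The undeformed point x = 2 differs from
q^n + q^(-n) by a multiple of Φ_n², which gives the cube (`pow_three_dvd_sum_clearedTerm_two_sub`).

Modulo Φ_d, the sequence `c` splits into blocks of length d, each proportional to the first one,
whose sum vanishes; the convolution then vanishes term by term (`hasValue_convolution_zero`). -/

/-! ### A terminating very-well-poised summation. -/

section WellPoised

variable {K : Type*} [Field K]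

/-- The quotient of consecutive terms of the very-well-poised series, without its
very-well-poised factor. -/
def wpRatio (a b Q Y : K) (i : ℕ) : K :=
  Q ^ (2 * i + 1) * (a / b) * ((1 - a * Q ^ i) * (1 - b * Q ^ i) * (1 - Y / Q ^ i)) /
    ((1 - Q ^ (i + 1)) * (1 - a * Q ^ (i + 1) / b) * (1 - a * (Q * Y) * Q ^ i))

/-- The terms of the very-well-poised series, without the very-well-poised factor. -/
def wpProd (a b Q Y : K) (k : ℕ) : K := ∏ i ∈ Finset.range k, wpRatio a b Q Y i

lemma wpProd_succ (a b Q Y : K) (k : ℕ) :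
    wpProd a b Q Y (k + 1) = wpProd a b Q Y k * wpRatio a b Q Y k :=
  Finset.prod_range_succ _ _

/-- Replacing Y by QY shifts the factors 1 - Y/Q^i by one index. Comparing index k+1 with index k
therefore avoids dividing by such a factor, which may vanish. -/
lemma wpProd_shift (a b Q Y : K) (hQ : Q ≠ 0)
    (hY : ∀ i : ℕ, 1 - a * (Q * Y) * Q ^ i ≠ 0) (k : ℕ) :
    wpProd a b Q (Q * Y) (k + 1) = wpProd a b Q Y k *
      ((1 - Q * Y) * (1 - a * (Q * Y)) *
        (Q ^ (2 * k + 1) * (a / b) * ((1 - a * Q ^ k) * (1 - b * Q ^ k)) /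
          ((1 - Q ^ (k + 1)) * (1 - a * Q ^ (k + 1) / b))) /
        ((1 - a * (Q * Y) * Q ^ k) * (1 - a * (Q * Y) * Q ^ (k + 1)))) := by
  induction k with
  | zero =>
    have h0 := hY 0
    simp only [pow_zero, mul_one] at h0
    simp only [wpProd, zero_add, Finset.prod_range_one, Finset.prod_range_zero, wpRatio, pow_zero,
      mul_one, mul_zero, div_one, one_mul, pow_one] at *
    have e : a * (Q * (Q * Y)) = a * (Q * Y) * Q := by ring
    rw [e]
    generalize 1 - a * Q / b = d
    generalize a / b = c
    generalize 1 - a * (Q * Y) * Q = v at *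
    have hu : (1 - a * (Q * Y)) * (1 - a * (Q * Y))⁻¹ = 1 := mul_inv_cancel₀ h0
    generalize 1 - a * (Q * Y) = u at *
    simp only [div_eq_mul_inv, mul_inv]
    generalize (1 - Q)⁻¹ * d⁻¹ = M
    linear_combination (-(1 - Q * Y) * (Q * c * ((1 - a) * (1 - b)) * M) * v⁻¹) * hu
  | succ k ih =>
    rw [wpProd_succ, ih, wpProd_succ a b Q Y]
    have h2 := hY (k + 1)
    have hz : Q ^ k ≠ 0 := pow_ne_zero _ hQ
    have e : Q * Y / Q ^ (k + 1) = Y / Q ^ k := by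
      rw [pow_succ]; field_simp
    have e' : a * (Q * (Q * Y)) * Q ^ (k + 1) = a * (Q * Y) * Q ^ (k + 2) := by ring
    simp only [wpRatio, e, e']
    simp only [show k + 1 + 1 = k + 2 from rfl]
    generalize 1 - a * (Q * Y) * Q ^ k = u at *
    generalize 1 - a * (Q * Y) * Q ^ (k + 1) = v at *
    generalize 1 - a * (Q * Y) * Q ^ (k + 2) = w at *
    generalize 1 - a * Q ^ (k + 1) / b = d
    generalize 1 - a * Q ^ (k + 2) / b = d'
    generalize 1 - Y / Q ^ k = g
    simp only [div_eq_mul_inv, mul_inv]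
    have : v * v⁻¹ = 1 := mul_inv_cancel₀ h2
    ring

/-- The inductive step of `wp_telescope` as a rational identity, with z = Q^k, y = QY, c = a/b and p
the k-th product. -/
lemma wp_telescope_step (b c y z Q p : K) (hz : z ≠ 0) (hQ : Q ≠ 0)
    (hE₁ : 1 - z * Q ≠ 0) (hE₂ : 1 - c * z * Q ≠ 0)
    (hu : 1 - b * c * y * z ≠ 0) (hv : 1 - b * c * y * z * Q ≠ 0) :
    -((1 - b * c * y) * y * c * z * (1 - b * c * z) * (1 - b * z) / (1 - b * c * y * z)) * p +
      ((1 - c * y) * ((1 - b * c * (z * Q) ^ 2) * (p * ((1 - y) * (1 - b * c * y) *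
        (z ^ 2 * Q * c * ((1 - b * c * z) * (1 - b * z)) / ((1 - z * Q) * (1 - c * z * Q))) /
        ((1 - b * c * y * z) * (1 - b * c * y * z * Q))))) -
      (1 - b * c * y) * ((1 - b * c * (z * Q) ^ 2) * (p *
        (z ^ 2 * Q * c * ((1 - b * c * z) * (1 - b * z) * (1 - y / (Q * z))) /
          ((1 - z * Q) * (1 - c * z * Q) * (1 - b * c * y * z)))))) =
    -((1 - b * c * y) * y * c * (z * Q) * (1 - b * c * (z * Q)) * (1 - b * (z * Q)) /
      (1 - b * c * y * z * Q)) * (p *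
        (z ^ 2 * Q * c * ((1 - b * c * z) * (1 - b * z) * (1 - y / (Q * z))) /
          ((1 - z * Q) * (1 - c * z * Q) * (1 - b * c * y * z)))) := by
  field_simp
  ring

/-- A contiguous relation in Y for partial sums. Its boundary term is a multiple of the last
product, hence disappears once the series has terminated. -/
lemma wp_telescope (a b Q Y : K) (hQ : Q ≠ 0) (hb : b ≠ 0) (hQi : ∀ i : ℕ, 1 - Q ^ (i + 1) ≠ 0)
    (hab : ∀ i : ℕ, 1 - a * Q ^ (i + 1) / b ≠ 0)
    (hY : ∀ i : ℕ, 1 - a * (Q * Y) * Q ^ i ≠ 0) (k : ℕ) :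
    (1 - a * (Q * Y) / b) *
        ∑ i ∈ Finset.range (k + 1), (1 - a * Q ^ (2 * i)) * wpProd a b Q (Q * Y) i -
      (1 - a * (Q * Y)) * ∑ i ∈ Finset.range (k + 1), (1 - a * Q ^ (2 * i)) * wpProd a b Q Y i =
      -((1 - a * (Q * Y)) * (Q * Y) * (a / b) * Q ^ k * (1 - a * Q ^ k) * (1 - b * Q ^ k) /
        (1 - a * (Q * Y) * Q ^ k)) * wpProd a b Q Y k := by
  induction k with
  | zero =>
    have h0 := hY 0
    simp only [pow_zero, mul_one] at h0
    simp only [wpProd, zero_add, Finset.sum_range_one, Finset.prod_range_zero, mul_zero, pow_zero,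
      mul_one]
    have h1 : 1 - a * Q * Y ≠ 0 := by rwa [mul_assoc]
    field_simp
    ring
  | succ k ih =>
    rw [Finset.sum_range_succ, Finset.sum_range_succ _ (k + 1), mul_add (1 - a * (Q * Y) / b),
      mul_add (1 - a * (Q * Y)), add_sub_add_comm, ih, wpProd_shift a b Q Y hQ hY, wpProd_succ]
    obtain ⟨c, rfl⟩ : ∃ c, a = b * c := ⟨a / b, by field_simp⟩
    have e (x : K) : b * c * x / b = c * x := by field_simp
    have e' : b * c / b = c := by field_simp
    have hz : Q ^ k ≠ 0 := pow_ne_zero _ hQ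
    have h1 := hY k
    have h2 := hY (k + 1)
    have h3 := hQi k
    have h4 := hab k
    have h5 : Y / Q ^ k = Q * Y / (Q * Q ^ k) := by field_simp
    simp only [wpRatio, e, e', h5] at *
    have h6 : Q ^ (2 * k + 1) = (Q ^ k) ^ 2 * Q := by ring
    have h7 : Q ^ (2 * (k + 1)) = (Q ^ k * Q) ^ 2 := by ring
    rw [h6, h7]
    simp only [pow_succ Q k] at *
    generalize Q ^ k = z at *
    generalize Q * Y = y at *
    convert wp_telescope_step b c y z Q (wpProd (b * c) b Q Y k) hz hQ h3
      (by rwa [mul_assoc]) h1 (by rwa [mul_assoc]) using 5 <;> ring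

/-- This is the limit c → ∞ of the terminating ₆φ₅ sum with parameters a, b, c, Q^(-N). Induction on
N works because `wp_telescope` relates Y = Q^N to Y = Q^(N+1). -/
lemma wp_sum (a b Q : K) (hQ : Q ≠ 0) (hb : b ≠ 0) (hQi : ∀ i : ℕ, 1 - Q ^ (i + 1) ≠ 0)
    (hab : ∀ i : ℕ, 1 - a * Q ^ (i + 1) / b ≠ 0)
    (ha : ∀ i : ℕ, 1 - a * Q ^ (i + 1) ≠ 0) (N : ℕ) :
    ∑ k ∈ Finset.range (N + 1), (1 - a * Q ^ (2 * k)) * wpProd a b Q (Q ^ N) k =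
      (1 - a) * ∏ i ∈ Finset.range N, ((1 - a * Q ^ (i + 1)) / (1 - a * Q ^ (i + 1) / b)) := by
  induction N with
  | zero => simp [wpProd]
  | succ N ih =>
    have hvan : wpProd a b Q (Q ^ N) (N + 1) = 0 := by
      rw [wpProd_succ, wpRatio, div_self (pow_ne_zero _ hQ)]
      simp
    have hY : ∀ i : ℕ, 1 - a * (Q * Q ^ N) * Q ^ i ≠ 0 := fun i => by
      convert ha (N + i) using 2
      ring
    have h := wp_telescope a b Q (Q ^ N) hQ hb hQi hab hY (N + 1)
    rw [hvan, mul_zero, sub_eq_zero, Finset.sum_range_succ _ (N + 1), Finset.sum_range_succ _ (N + 1),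
      hvan, mul_zero, add_zero, ih, ← Finset.sum_range_succ, ← pow_succ'] at h
    rw [Finset.prod_range_succ, ← mul_assoc, ← mul_div_assoc, eq_div_iff (hab N)]
    rw [mul_comm, h]
    ring

end WellPoised

/-! ### The deformation in x = a + 1/a; x = 2 is the original series. -/

section CubicFactors

variable {R : Type*} [CommRing R]

lemma one_sub_mul_qInt (q : R) (n : ℕ) : (1 - q) * qInt q n = 1 - q ^ n :=
  mul_neg_geom_sum q n

/-- The factor `(1 - a q^(2i+1)) (1 - q^(2i+1) / a) (1 - q^(2i+1))` with `x = a + 1 / a`. -/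
def oddFactor (q x : R) (i : ℕ) : R :=
  (1 + q ^ (4 * i + 2) - q ^ (2 * i + 1) * x) * (1 - q ^ (2 * i + 1))

/-- The factor `(1 - a q^(2i+2)) (1 - q^(2i+2) / a) (1 - q^(2i+2))` with `x = a + 1 / a`. -/
def evenFactor (q x : R) (i : ℕ) : R :=
  (1 + q ^ (4 * i + 4) - q ^ (2 * i + 2) * x) * (1 - q ^ (2 * i + 2))

/-- The one-parameter deformation of `cTerm q k`, cleared of denominators. -/
def clearedTerm (q x : R) (m k : ℕ) : R :=
  (-1) ^ k * q ^ (k ^ 2) * qInt q (4 * k + 1) *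
    ((∏ i ∈ Finset.range k, oddFactor q x i) * ∏ i ∈ Finset.Ico k m, evenFactor q x i)

lemma clearedTerm_mul (q x : R) {m k : ℕ} (h : k ≤ m) :
    clearedTerm q x m k * ∏ i ∈ Finset.range k, evenFactor q x i =
      (-1) ^ k * q ^ (k ^ 2) * qInt q (4 * k + 1) * (∏ i ∈ Finset.range k, oddFactor q x i) *
        ∏ i ∈ Finset.range m, evenFactor q x i := by
  rw [clearedTerm, ← Finset.prod_range_mul_prod_Ico _ h]
  ring

lemma oddFactor_two (q : R) (i : ℕ) : oddFactor q 2 i = (1 - q * (q ^ 2) ^ i) ^ 3 := by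
  rw [oddFactor]; ring

lemma evenFactor_two (q : R) (i : ℕ) : evenFactor q 2 i = (1 - q ^ 2 * (q ^ 2) ^ i) ^ 3 := by
  rw [evenFactor]; ring

end CubicFactors

/-! ### Exact evaluation at a = q^(2m+1). -/

section RootSum

variable {K : Type*} [Field K]

lemma wpRatio_eq_div (q : K) (hq : q ≠ 0) (m i : ℕ) :
    wpRatio q (q ^ (2 * m + 2)) (q ^ 2) ((q ^ 2) ^ m) i = -(q ^ (2 * i + 1)) *
      (oddFactor q (q ^ (2 * m + 1) + (q ^ (2 * m + 1))⁻¹) i /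
        evenFactor q (q ^ (2 * m + 1) + (q ^ (2 * m + 1))⁻¹) i) := by
  set u := q ^ m with hu
  have hu0 : u ≠ 0 := pow_ne_zero _ hq
  set z := q ^ i with hz
  have hz0 : z ≠ 0 := pow_ne_zero _ hq
  have e1 : oddFactor q (q ^ (2 * m + 1) + (q ^ (2 * m + 1))⁻¹) i =
      (1 - z ^ 2 * q * (u ^ 2 * q)) * (1 - z ^ 2 / u ^ 2) * (1 - z ^ 2 * q) := by
    rw [oddFactor]
    simp only [pow_add, pow_mul', ← hu, ← hz]
    field_simp
    ring
  have e2 : evenFactor q (q ^ (2 * m + 1) + (q ^ (2 * m + 1))⁻¹) i =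
      (1 - z ^ 2 * q ^ 2 * (u ^ 2 * q)) * (1 - z ^ 2 * q / u ^ 2) * (1 - z ^ 2 * q ^ 2) := by
    rw [evenFactor]
    simp only [pow_add, pow_mul', ← hu, ← hz]
    field_simp
    ring
  rw [e1, e2, wpRatio]
  have e3 : (q ^ 2) ^ i = z ^ 2 := by rw [hz]; ring
  have e4 : (q ^ 2) ^ m = u ^ 2 := by rw [hu]; ring
  rw [pow_succ (q ^ 2) (2 * i), pow_mul' (q ^ 2) 2 i, pow_succ (q ^ 2) i, pow_add q (2 * m),
    pow_mul' q 2 m, pow_succ q (2 * i), pow_mul' q 2 i, e3, e4, ← hu, ← hz]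
  have e5 : q * (z ^ 2 * q ^ 2) / (u ^ 2 * q ^ 2) = z ^ 2 * q / u ^ 2 := by field_simp
  have e6 : 1 - u ^ 2 / z ^ 2 = -(u ^ 2 / z ^ 2) * (1 - z ^ 2 / u ^ 2) := by field_simp; ring
  rw [e5, e6]
  simp only [div_eq_mul_inv, mul_inv]
  have e7 : (1 - q * (q ^ 2 * u ^ 2) * z ^ 2)⁻¹ = (1 - z ^ 2 * q ^ 2 * (u ^ 2 * q))⁻¹ := by
    congr 1; ring
  rw [e7]
  have e8 : (z ^ 2) ^ 2 * q ^ 2 * (q * ((u ^ 2)⁻¹ * (q ^ 2)⁻¹)) * (u ^ 2 * (z ^ 2)⁻¹) =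
      z ^ 2 * q := by field_simp
  linear_combination (-(1 - q * z ^ 2) * (1 - u ^ 2 * q ^ 2 * z ^ 2) *
    (1 - z ^ 2 * (u ^ 2)⁻¹) * ((1 - z ^ 2 * q ^ 2)⁻¹ * (1 - z ^ 2 * q * (u ^ 2)⁻¹)⁻¹ *
      (1 - z ^ 2 * q ^ 2 * (u ^ 2 * q))⁻¹)) * e8

lemma prod_neg_pow_odd (q : K) (k : ℕ) :
    ∏ i ∈ Finset.range k, -(q ^ (2 * i + 1)) = (-1) ^ k * q ^ (k ^ 2) := by
  induction k with
  | zero => simp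
  | succ k ih => rw [Finset.prod_range_succ, ih]; ring

/-- Reversing the product turns the factors into 1 - q^(-(2i+1)), and -q^(2i+1) is absorbed into
each. -/
lemma prod_odd_reflect (q : K) (hq : q ≠ 0) (m : ℕ) :
    ((-1) ^ m * q ^ (m ^ 2)) * ∏ i ∈ Finset.range m, (1 - q * (q ^ 2) ^ (i + 1) / q ^ (2 * m + 2)) =
      ∏ i ∈ Finset.range m, (1 - q ^ (2 * i + 1)) := by
  rw [← prod_neg_pow_odd, ← Finset.prod_range_reflect (fun i => 1 - q * (q ^ 2) ^ (i + 1) / _),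
    ← Finset.prod_mul_distrib]
  refine Finset.prod_congr rfl fun i hi => ?_
  obtain ⟨j, rfl⟩ : ∃ j, m = i + 1 + j := ⟨m - (i + 1), by
    have := Finset.mem_range.1 hi; omega⟩
  rw [show i + 1 + j - 1 - i = j by omega]
  have hq' : q ^ j ≠ 0 := pow_ne_zero _ hq
  have hq'' : q ^ i ≠ 0 := pow_ne_zero _ hq
  simp only [← pow_mul, mul_add, pow_add]
  simp only [pow_mul' q 2 j, pow_mul' q 2 i]
  field_simp
  ring

lemma sum_clearedTerm_root (q : K) (hq : q ≠ 0) (hqi : ∀ i : ℕ, 1 - q ^ (i + 1) ≠ 0) (m : ℕ) :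
    ∑ k ∈ Finset.range (m + 1), clearedTerm q (q ^ (2 * m + 1) + (q ^ (2 * m + 1))⁻¹) m k =
      (-1) ^ m * q ^ (m ^ 2) * qInt q (2 * m + 1) *
        ∏ i ∈ Finset.range m, evenFactor q (q ^ (2 * m + 1) + (q ^ (2 * m + 1))⁻¹) i := by
  set x := q ^ (2 * m + 1) + (q ^ (2 * m + 1))⁻¹ with hx
  -- No positive power of q is 1, so odd and even powers never coincide; this keeps all denominators
  -- nonzero.
  have hodd (i j : ℕ) (h : (2 * i + 1 : ℤ) ≠ 2 * j) : q ^ (2 * i + 1) ≠ q ^ (2 * j) := by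
    intro he
    rcases lt_or_ge (2 * i + 1) (2 * j) with hlt | hge
    · apply hqi (2 * j - (2 * i + 1) - 1)
      rw [sub_eq_zero]
      apply mul_left_cancel₀ (pow_ne_zero (2 * i + 1) hq)
      rw [← pow_add, mul_one, he]
      congr 1; omega
    · apply hqi (2 * i - 2 * j)
      rw [sub_eq_zero]
      apply mul_left_cancel₀ (pow_ne_zero (2 * j) hq)
      rw [← pow_add, mul_one, ← he]
      congr 1; omega
  have hD (i : ℕ) : evenFactor q x i ≠ 0 := by
    have e : evenFactor q x i = (1 - q ^ (2 * i + 2 + 2 * m + 1)) *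
        (1 - q ^ (2 * (i + 1)) / q ^ (2 * m + 1)) * (1 - q ^ (2 * i + 1 + 1)) := by
      rw [evenFactor, hx]
      have : q ^ (2 * m + 1) ≠ 0 := pow_ne_zero _ hq
      field_simp
      ring
    rw [e]
    refine mul_ne_zero (mul_ne_zero (hqi _) ?_) (hqi _)
    rw [sub_ne_zero, ne_comm, Ne, div_eq_one_iff_eq (pow_ne_zero _ hq)]
    exact (hodd m (i + 1) (by omega)).symm
  have hDp (k : ℕ) : ∏ i ∈ Finset.range k, evenFactor q x i ≠ 0 :=
    Finset.prod_ne_zero_iff.2 fun i _ => hD i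
  have hwp (k : ℕ) : wpProd q (q ^ (2 * m + 2)) (q ^ 2) ((q ^ 2) ^ m) k =
      (-1) ^ k * q ^ (k ^ 2) * ((∏ i ∈ Finset.range k, oddFactor q x i) /
        ∏ i ∈ Finset.range k, evenFactor q x i) := by
    rw [wpProd, ← prod_neg_pow_odd, ← Finset.prod_div_distrib, ← Finset.prod_mul_distrib]
    exact Finset.prod_congr rfl fun i _ => wpRatio_eq_div q hq m i
  have h1 : 1 - q ≠ 0 := by simpa using hqi 0
  have key := wp_sum q (q ^ (2 * m + 2)) (q ^ 2) (pow_ne_zero _ hq) (pow_ne_zero _ hq)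
    (fun i => by rw [← pow_mul, show 2 * (i + 1) = 2 * i + 1 + 1 by ring]; exact hqi _)
    (fun i => by
      rw [sub_ne_zero, ne_comm, Ne, div_eq_one_iff_eq (pow_ne_zero _ hq), ← pow_mul, ← pow_succ']
      exact hodd (i + 1) (m + 1) (by omega))
    (fun i => by rw [← pow_mul, ← pow_succ']; exact hqi _) m
  -- Multiplying by 1 - q turns [4k+1] into the very-well-poised factor 1 - q^(4k+1).
  have hterm (k : ℕ) (hk : k ∈ Finset.range (m + 1)) : (1 - q) * clearedTerm q x m k =
      (∏ i ∈ Finset.range m, evenFactor q x i) * ((1 - q * (q ^ 2) ^ (2 * k)) *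
        wpProd q (q ^ (2 * m + 2)) (q ^ 2) ((q ^ 2) ^ m) k) := by
    have hc := clearedTerm_mul q x (Nat.lt_succ_iff.1 (Finset.mem_range.1 hk))
    rw [← eq_div_iff (hDp k)] at hc
    have hi := one_sub_mul_qInt q (4 * k + 1)
    rw [hc, hwp]
    rw [show 1 - q * (q ^ 2) ^ (2 * k) = 1 - q ^ (4 * k + 1) by ring, ← hi]
    ring
  apply mul_left_cancel₀ h1
  rw [Finset.mul_sum, Finset.sum_congr rfl hterm, ← Finset.mul_sum, key, Finset.prod_div_distrib]
  have hr := prod_odd_reflect q hq m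
  have hi := one_sub_mul_qInt q (2 * m + 1)
  have hs : (1 - q) * ∏ i ∈ Finset.range m, (1 - q * (q ^ 2) ^ (i + 1)) =
      (∏ i ∈ Finset.range m, (1 - q ^ (2 * i + 1))) * (1 - q ^ (2 * m + 1)) := by
    rw [← Finset.prod_range_succ, Finset.prod_range_succ', mul_comm]
    congr 1
    · exact Finset.prod_congr rfl fun i _ => by ring
    · simp
  have hne : ∏ i ∈ Finset.range m, (1 - q * (q ^ 2) ^ (i + 1) / q ^ (2 * m + 2)) ≠ 0 :=
    Finset.prod_ne_zero_iff.2 fun i _ => by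
      rw [sub_ne_zero, ne_comm, Ne, div_eq_one_iff_eq (pow_ne_zero _ hq), ← pow_mul, ← pow_succ']
      exact hodd (i + 1) (m + 1) (by omega)
  rw [← mul_div_assoc (1 - q), hs, ← hr, ← hi]
  generalize ∏ i ∈ Finset.range m, (1 - q * (q ^ 2) ^ (i + 1) / q ^ (2 * m + 2)) = p at hne
  field_simp

end RootSum

/-! ### Reversal of products. -/

section Reflection

variable {R : Type*} [CommRing R]

/-- Used to trade even products for odd ones at a root of unity, through i ↦ m-1-i. -/
lemma prod_range_reflect_mul {m : ℕ} {f g u : ℕ → R}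
    (h : ∀ i j, i + 1 + j = m → f j * u i = g i) (j : ℕ) (hj : j ≤ m) :
    (∏ i ∈ Finset.range (m - j), f i) * ∏ i ∈ Finset.range j, g i =
      (∏ i ∈ Finset.range m, f i) * ∏ i ∈ Finset.range j, u i := by
  induction j with
  | zero => simp
  | succ j ih =>
    rw [Finset.prod_range_succ g, Finset.prod_range_succ u, ← mul_assoc _ _ (u j), ← ih (by omega),
      ← h j (m - (j + 1)) (by omega), show m - j = m - (j + 1) + 1 by omega,
      Finset.prod_range_succ]
    ring

lemma prod_neg_pow_even (ζ : R) (j : ℕ) :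
    ∏ i ∈ Finset.range j, -ζ ^ (2 * i + 2) = (-1) ^ j * ζ ^ (j * (j + 1)) := by
  induction j with
  | zero => simp
  | succ j ih => rw [Finset.prod_range_succ, ih]; ring

lemma prod_neg_pow_six (ζ : R) (j : ℕ) :
    ∏ i ∈ Finset.range j, -ζ ^ (6 * i + 6) = (-1) ^ j * ζ ^ (3 * (j * (j + 1))) := by
  induction j with
  | zero => simp
  | succ j ih => rw [Finset.prod_range_succ, ih]; ring

end Reflection

/-! ### Symmetries of the terms at a root of unity. -/

section RootOfUnity

variable {F : Type*} [Field F] {ζ : F}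

/-- After multiplication by 1 - ζ the two sides become ζ^a - ζ^b and -(ζ^b - ζ^a). -/
lemma qInt_mul_pow_antisymm {n a b u v : ℕ} (hζ : ζ ^ n = 1) (h1 : ζ ≠ 1)
    (h : a ≡ b + v [MOD n]) (h' : b ≡ a + u [MOD n]) :
    ζ ^ a * qInt ζ u = -(ζ ^ b * qInt ζ v) := by
  have h2 := pow_eq_pow_of_modEq h hζ
  have h3 := pow_eq_pow_of_modEq h' hζ
  have e1 := one_sub_mul_qInt ζ u
  have e2 := one_sub_mul_qInt ζ v
  rw [pow_add] at h2 h3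
  apply mul_left_cancel₀ (sub_ne_zero.2 h1.symm)
  linear_combination ζ ^ a * e1 + ζ ^ b * e2 + h2 + h3

lemma qInt_pow_mul_antisymm_head {j k : ℕ} (hζ : ζ ^ (2 * (j + k) + 1) = 1) (h1 : ζ ≠ 1) :
    ζ ^ (j ^ 2 + 3 * (k * (k + 1))) * qInt ζ (4 * j + 1) =
      -(ζ ^ (k ^ 2 + 3 * (j * (j + 1))) * qInt ζ (4 * k + 1)) := by
  refine qInt_mul_pow_antisymm hζ h1 ?_ ?_ <;> rw [Nat.modEq_iff_dvd]
  · exact ⟨j - k + 1, by push_cast; ring⟩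
  · exact ⟨k - j + 1, by push_cast; ring⟩

lemma qInt_pow_mul_antisymm_tail {r s : ℕ} (hζ : ζ ^ (2 * (r + s + 1) + 1) = 1) (h1 : ζ ≠ 1) :
    ζ ^ ((r + s + 1 + 1 + s) ^ 2 + 3 * (s * (s + 1))) * qInt ζ (4 * (r + s + 1 + 1 + s) + 1) =
      -(ζ ^ ((r + s + 1 + 1 + r) ^ 2 + 3 * (r * (r + 1))) *
        qInt ζ (4 * (r + s + 1 + 1 + r) + 1)) := by
  refine qInt_mul_pow_antisymm hζ h1 ?_ ?_ <;> rw [Nat.modEq_iff_dvd]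
  · exact ⟨3 * (r - s + 1), by push_cast; ring⟩
  · exact ⟨3 * (s - r + 1), by push_cast; ring⟩

lemma one_sub_reflect {m : ℕ} (hζ : ζ ^ (2 * m + 1) = 1) (i j : ℕ) (h : i + 1 + j = m) :
    (1 - ζ ^ (2 * j + 1)) * -ζ ^ (2 * i + 2) = 1 - ζ ^ (2 * i + 2) := by
  subst h
  linear_combination hζ

/-- The exponents 2j+1 and 2i+2 add up to 2m+1, so the two powers are inverse, and 1 + t² - t x is
self-reciprocal in t. -/
lemma oddFactor_reflect {m : ℕ} (hζ : ζ ^ (2 * m + 1) = 1) (x : F) (i j : ℕ) (h : i + 1 + j = m) :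
    oddFactor ζ x j * -ζ ^ (6 * i + 6) = evenFactor ζ x i := by
  subst h
  have h1 : ζ ^ (2 * j + 1) * ζ ^ (2 * i + 2) = 1 := by rw [← pow_add, ← hζ]; ring
  have e1 : ζ ^ (4 * j + 2) = (ζ ^ (2 * j + 1)) ^ 2 := by ring
  have e2 : ζ ^ (4 * i + 4) = (ζ ^ (2 * i + 2)) ^ 2 := by ring
  have e3 : ζ ^ (6 * i + 6) = (ζ ^ (2 * i + 2)) ^ 3 := by ring
  rw [oddFactor, evenFactor, e1, e2, e3]
  generalize ζ ^ (2 * j + 1) = a at *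
  generalize ζ ^ (2 * i + 2) = b at *
  have h2 : (1 + a ^ 2 - a * x) * b ^ 2 = 1 + b ^ 2 - b * x := by
    linear_combination (a * b + 1 - b * x) * h1
  rw [← h2]
  linear_combination (1 + a ^ 2 - a * x) * b ^ 2 * h1

lemma clearedTerm_antisymm {j k m : ℕ} (hm : j + k = m) (hζ : ζ ^ (2 * m + 1) = 1) (h1 : ζ ≠ 1)
    (x : F) (hx : ∏ i ∈ Finset.range m, evenFactor ζ x i ≠ 0) :
    clearedTerm ζ x m j = -clearedTerm ζ x m k := by
  have hne (l : ℕ) (hl : l ≤ m) : ∏ i ∈ Finset.range l, evenFactor ζ x i ≠ 0 := fun h0 => hx <| by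
    rw [← Finset.prod_range_mul_prod_Ico _ hl, h0, zero_mul]
  have hj := clearedTerm_mul ζ x (show j ≤ m by omega)
  have hk := clearedTerm_mul ζ x (show k ≤ m by omega)
  have rj := prod_range_reflect_mul (oddFactor_reflect hζ x) j (by omega)
  have rk := prod_range_reflect_mul (oddFactor_reflect hζ x) k (by omega)
  rw [prod_neg_pow_six, show m - j = k by omega] at rj
  rw [prod_neg_pow_six, show m - k = j by omega] at rk
  have hq := qInt_pow_mul_antisymm_head (j := j) (k := k) (by rwa [hm]) h1
  apply mul_right_cancel₀ (mul_ne_zero (hne j (by omega)) (hne k (by omega)))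
  rw [← mul_assoc, hj, neg_mul, mul_comm (∏ i ∈ Finset.range j, evenFactor ζ x i), ← mul_assoc, hk]
  rw [pow_add, pow_add] at hq
  linear_combination (∏ i ∈ Finset.range m, evenFactor ζ x i) *
    ((-1) ^ j * ζ ^ j ^ 2 * qInt ζ (4 * j + 1) * rk + (-1) ^ k * ζ ^ k ^ 2 * qInt ζ (4 * k + 1) * rj
      + (-1) ^ j * (-1) ^ k * (∏ i ∈ Finset.range m, oddFactor ζ x i) * hq)

lemma sum_clearedTerm_eq_zero [CharZero F] {m : ℕ} (hζ : ζ ^ (2 * m + 1) = 1) (h1 : ζ ≠ 1)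
    (x : F) (hx : ∏ i ∈ Finset.range m, evenFactor ζ x i ≠ 0) :
    ∑ k ∈ Finset.range (m + 1), clearedTerm ζ x m k = 0 := by
  rw [← self_eq_neg, ← Finset.sum_neg_distrib]
  nth_rw 1 [← Finset.sum_range_reflect]
  refine Finset.sum_congr rfl fun k hk => clearedTerm_antisymm ?_ hζ h1 x hx
  have := Finset.mem_range.1 hk
  omega

lemma IsPrimitiveRoot.one_sub_pow_ne_zero {n k : ℕ} (hζ : IsPrimitiveRoot ζ n) (h : ¬ n ∣ k) :
    1 - ζ ^ k ≠ 0 := fun h0 => h ((hζ.pow_eq_one_iff_dvd k).1 (sub_eq_zero.1 h0).symm)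

lemma qPoch_even_ne_zero {n k : ℕ} (hn : Odd n) (hζ : IsPrimitiveRoot ζ n) (hk : k < n) :
    qPoch (ζ ^ 2) (ζ ^ 2) k ≠ 0 := by
  refine Finset.prod_ne_zero_iff.2 fun i hi => ?_
  rw [← pow_succ', ← pow_mul]
  refine hζ.one_sub_pow_ne_zero fun h => ?_
  have hc : Nat.Coprime n 2 := Nat.coprime_two_right.2 hn
  have := Nat.le_of_dvd (by omega) (hc.dvd_of_dvd_mul_left h)
  have := Finset.mem_range.1 hi
  omega

lemma prod_oddFactor_two {R : Type*} [CommRing R] (q : R) (k : ℕ) :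
    ∏ i ∈ Finset.range k, oddFactor q 2 i = qPoch q (q ^ 2) k ^ 3 := by
  rw [qPoch, ← Finset.prod_pow]
  exact Finset.prod_congr rfl fun i _ => oddFactor_two q i

lemma prod_evenFactor_two {R : Type*} [CommRing R] (q : R) (k : ℕ) :
    ∏ i ∈ Finset.range k, evenFactor q 2 i = qPoch (q ^ 2) (q ^ 2) k ^ 3 := by
  rw [qPoch, ← Finset.prod_pow]
  exact Finset.prod_congr rfl fun i _ => evenFactor_two q i

lemma cTerm_mul_eq_clearedTerm (q : F) {k m : ℕ} (hk : k ≤ m)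
    (h0 : qPoch (q ^ 2) (q ^ 2) k ≠ 0) :
    cTerm q k * qPoch (q ^ 2) (q ^ 2) m ^ 3 = clearedTerm q 2 m k := by
  have h := clearedTerm_mul q 2 hk
  rw [prod_evenFactor_two, prod_evenFactor_two, prod_oddFactor_two] at h
  apply mul_right_cancel₀ (pow_ne_zero 3 h0)
  rw [h, cTerm]
  field_simp

lemma cTerm_antisymm {j k m : ℕ} (hm : j + k = m) (hζ : IsPrimitiveRoot ζ (2 * m + 1))
    (hm0 : m ≠ 0) : cTerm ζ j = -cTerm ζ k := by
  have hd (l : ℕ) (hl : l ≤ m) := qPoch_even_ne_zero ⟨m, rfl⟩ hζ (show l < 2 * m + 1 by omega)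
  have h := clearedTerm_antisymm hm hζ.pow_eq_one (hζ.ne_one (by omega)) 2
    (by rw [prod_evenFactor_two]; exact pow_ne_zero _ (hd m le_rfl))
  apply mul_right_cancel₀ (pow_ne_zero 3 (hd m le_rfl))
  rw [neg_mul, cTerm_mul_eq_clearedTerm ζ (by omega) (hd j (by omega)),
    cTerm_mul_eq_clearedTerm ζ (by omega) (hd k (by omega)), h]

lemma cTerm_eq_zero {k m : ℕ} (hζ : ζ ^ (2 * m + 1) = 1) (hk : m < k) :
    cTerm ζ k = 0 := by
  have : qPoch ζ (ζ ^ 2) k = 0 :=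
    Finset.prod_eq_zero (Finset.mem_range.2 hk) (by rw [← pow_mul, ← pow_succ', hζ, sub_self])
  rw [cTerm, this]
  simp

lemma sum_cTerm_half_eq_zero [CharZero F] {m : ℕ} (hζ : IsPrimitiveRoot ζ (2 * m + 1)) (hm0 : m ≠ 0) :
    ∑ k ∈ Finset.range (m + 1), cTerm ζ k = 0 := by
  rw [← self_eq_neg, ← Finset.sum_neg_distrib]
  nth_rw 1 [← Finset.sum_range_reflect]
  refine Finset.sum_congr rfl fun k hk => cTerm_antisymm ?_ hζ hm0
  have := Finset.mem_range.1 hk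
  omega

lemma sum_cTerm_eq_zero [CharZero F] {m s : ℕ} (hζ : IsPrimitiveRoot ζ (2 * m + 1)) (hm0 : m ≠ 0)
    (hs : m < s) : ∑ k ∈ Finset.range s, cTerm ζ k = 0 := by
  obtain ⟨t, rfl⟩ := Nat.exists_eq_add_of_lt hs
  rw [show m + t + 1 = m + 1 + t by ring, Finset.sum_range_add, sum_cTerm_half_eq_zero hζ hm0,
    zero_add]
  exact Finset.sum_eq_zero fun k _ => cTerm_eq_zero hζ.pow_eq_one (by omega)

/-- The half sum vanishes, and by antisymmetry its last s+1 terms are the negatives of its first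
s+1. -/
lemma sum_cTerm_symm [CharZero F] {m r s : ℕ} (hζ : IsPrimitiveRoot ζ (2 * m + 1)) (hrs : r + s + 1 = m) :
    ∑ k ∈ Finset.range (r + 1), cTerm ζ k = ∑ k ∈ Finset.range (s + 1), cTerm ζ k := by
  have h := sum_cTerm_half_eq_zero hζ (by omega)
  rw [show m + 1 = r + 1 + (s + 1) by omega, Finset.sum_range_add,
    ← Finset.sum_range_reflect (fun k => cTerm ζ (r + 1 + k)), add_eq_zero_iff_eq_neg] at h
  rw [h, ← Finset.sum_neg_distrib]
  refine Finset.sum_congr rfl fun k hk => ?_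
  have := Finset.mem_range.1 hk
  rw [cTerm_antisymm (k := k) (m := m) (by omega) hζ (by omega), neg_neg]

/-- The value at a primitive `(2m+1)`-st root of unity `ζ` of
`cTerm q (m+1+r) / (1 - q^(2m+1))^3`. -/
def tailTerm (ζ : F) (m r : ℕ) : F :=
  (-1) ^ (m + 1 + r) * ζ ^ ((m + 1 + r) ^ 2) * qInt ζ (4 * (m + 1 + r) + 1) *
    ((∏ i ∈ Finset.range m, (1 - ζ ^ (2 * i + 1))) * (∏ i ∈ Finset.range r, (1 - ζ ^ (2 * i + 2))) /
      ((∏ i ∈ Finset.range m, (1 - ζ ^ (2 * i + 2))) *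
        ∏ i ∈ Finset.range (r + 1), (1 - ζ ^ (2 * i + 1)))) ^ 3

lemma tailTerm_antisymm {m r s : ℕ} (hζ : IsPrimitiveRoot ζ (2 * m + 1)) (hrs : r + s + 1 = m) :
    tailTerm ζ m r = -tailTerm ζ m s := by
  have hn (k : ℕ) (hk : k ≤ m) : ∏ i ∈ Finset.range k, (1 - ζ ^ (2 * i + 1)) ≠ 0 :=
    Finset.prod_ne_zero_iff.2 fun i hi => hζ.one_sub_pow_ne_zero fun h => by
      have := Finset.mem_range.1 hi
      have := Nat.le_of_dvd (by omega) h
      omega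
  have rr := prod_range_reflect_mul (one_sub_reflect hζ.pow_eq_one) r (by omega)
  have rs := prod_range_reflect_mul (one_sub_reflect hζ.pow_eq_one) s (by omega)
  rw [prod_neg_pow_even, show m - r = s + 1 by omega] at rr
  rw [prod_neg_pow_even, show m - s = r + 1 by omega] at rs
  have hq := qInt_pow_mul_antisymm_tail (ζ := ζ) (r := r) (s := s)
    (by rw [hrs]; exact hζ.pow_eq_one) (hζ.ne_one (by omega))
  rw [hrs, pow_add, pow_add] at hq
  have hr0 := hn (r + 1) (by omega)
  have hs0 := hn (s + 1) (by omega)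
  simp only [tailTerm]
  set A := ∏ i ∈ Finset.range r, (1 - ζ ^ (2 * i + 2))
  set B := ∏ i ∈ Finset.range s, (1 - ζ ^ (2 * i + 2))
  set P := ∏ i ∈ Finset.range (r + 1), (1 - ζ ^ (2 * i + 1))
  set Q := ∏ i ∈ Finset.range (s + 1), (1 - ζ ^ (2 * i + 1))
  set T := ∏ i ∈ Finset.range m, (1 - ζ ^ (2 * i + 1))
  set D := ∏ i ∈ Finset.range m, (1 - ζ ^ (2 * i + 2))
  -- Over the common denominator P Q the numerators are A Q and B P, the products that reflection
  -- evaluates.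
  have e1 : T * A / (D * P) = T / D * (A * Q) / (P * Q) := by field_simp
  have e2 : T * B / (D * Q) = T / D * (B * P) / (P * Q) := by field_simp
  rw [e1, e2, mul_comm A, mul_comm B, rr, rs]
  have p1 (k : ℕ) : ((-1 : F) ^ k) ^ 3 * (-1) ^ k = 1 := by
    rw [← pow_succ, ← pow_mul, Even.neg_one_pow ⟨2 * k, by ring⟩]
  have p2 := p1 r
  have p3 := p1 s
  rw [pow_add (-1 : F) _ r, pow_add (-1 : F) _ s]
  generalize T / D = u
  rw [pow_mul' ζ 3, pow_mul' ζ 3] at hq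
  simp only [div_eq_mul_inv]
  linear_combination (-1) ^ (m + 1) * (u * T * (P * Q)⁻¹) ^ 3 *
    (ζ ^ (m + 1 + r) ^ 2 * (ζ ^ (r * (r + 1))) ^ 3 * qInt ζ (4 * (m + 1 + r) + 1) * p2 +
     ζ ^ (m + 1 + s) ^ 2 * (ζ ^ (s * (s + 1))) ^ 3 * qInt ζ (4 * (m + 1 + s) + 1) * p3 + hq)

lemma sum_tailTerm_mul_eq_zero [CharZero F] {m : ℕ} (hζ : IsPrimitiveRoot ζ (2 * m + 1)) :
    ∑ r ∈ Finset.range m, tailTerm ζ m r * ∑ j ∈ Finset.range (m - r), cTerm ζ j = 0 := by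
  rw [← self_eq_neg, ← Finset.sum_neg_distrib]
  nth_rw 1 [← Finset.sum_range_reflect]
  refine Finset.sum_congr rfl fun r hr => ?_
  have := Finset.mem_range.1 hr
  rw [tailTerm_antisymm (s := r) hζ (by omega), show m - (m - 1 - r) = r + 1 by omega,
    show m - r = (m - 1 - r) + 1 by omega, sum_cTerm_symm (s := m - 1 - r) hζ (by omega), neg_mul]

end RootOfUnity

/-! ### Compatibility with ring homomorphisms, and residues of regular elements. -/

section MapLemmas

variable {R S : Type*} [CommRing R] [CommRing S] (f : R →+* S)

lemma map_qPoch (a q : R) (k : ℕ) : f (qPoch a q k) = qPoch (f a) (f q) k := by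
  simp [qPoch]

lemma map_qInt (q : R) (k : ℕ) : f (qInt q k) = qInt (f q) k := by
  simp [qInt]

lemma map_oddFactor (q x : R) (i : ℕ) : f (oddFactor q x i) = oddFactor (f q) (f x) i := by
  simp [oddFactor]

lemma map_evenFactor (q x : R) (i : ℕ) : f (evenFactor q x i) = evenFactor (f q) (f x) i := by
  simp [evenFactor]

lemma map_clearedTerm (q x : R) (m k : ℕ) :
    f (clearedTerm q x m k) = clearedTerm (f q) (f x) m k := by
  simp [clearedTerm, map_qInt, map_oddFactor, map_evenFactor]

lemma qPoch_add (a q : R) (k l : ℕ) : qPoch a q (k + l) = qPoch a q k * qPoch (a * q ^ k) q l := by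
  rw [qPoch, Finset.prod_range_add]
  congr 1
  exact Finset.prod_congr rfl fun i _ => by rw [pow_add, mul_assoc]

lemma qPoch_succ (a q : R) (k : ℕ) : qPoch a q (k + 1) = qPoch a q k * (1 - a * q ^ k) :=
  Finset.prod_range_succ _ _

end MapLemmas

section HasValue

variable {O F K : Type*} [CommRing O] [Field F] [Field K]

/-- `f` lies in the ring `ι(O)` and its residue under `φ` is `v`. -/
def HasValue (ι : O →+* K) (φ : O →+* F) (f : K) (v : F) : Prop := ∃ x, ι x = f ∧ φ x = v

variable {ι : O →+* K} {φ : O →+* F}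

lemma HasValue.of (x : O) : HasValue ι φ (ι x) (φ x) := ⟨x, rfl, rfl⟩

lemma HasValue.add {f g : K} {v w : F} (hf : HasValue ι φ f v) (hg : HasValue ι φ g w) :
    HasValue ι φ (f + g) (v + w) := by
  obtain ⟨x, rfl, rfl⟩ := hf
  obtain ⟨y, rfl, rfl⟩ := hg
  exact ⟨x + y, map_add _ _ _, map_add _ _ _⟩

lemma HasValue.mul {f g : K} {v w : F} (hf : HasValue ι φ f v) (hg : HasValue ι φ g w) :
    HasValue ι φ (f * g) (v * w) := by
  obtain ⟨x, rfl, rfl⟩ := hf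
  obtain ⟨y, rfl, rfl⟩ := hg
  exact ⟨x * y, map_mul _ _ _, map_mul _ _ _⟩

lemma HasValue.pow {f : K} {v : F} (hf : HasValue ι φ f v) (k : ℕ) :
    HasValue ι φ (f ^ k) (v ^ k) := by
  obtain ⟨x, rfl, rfl⟩ := hf
  exact ⟨x ^ k, map_pow _ _ _, map_pow _ _ _⟩

lemma HasValue.sum {f : ℕ → K} {v : ℕ → F} {s : Finset ℕ}
    (h : ∀ i ∈ s, HasValue ι φ (f i) (v i)) : HasValue ι φ (∑ i ∈ s, f i) (∑ i ∈ s, v i) := by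
  induction s using Finset.cons_induction with
  | empty => exact ⟨0, by simp, by simp⟩
  | cons a s ha ih =>
    rw [Finset.sum_cons, Finset.sum_cons]
    exact (h a (Finset.mem_cons_self _ _)).add (ih fun i hi => h i (Finset.mem_cons_of_mem hi))

lemma HasValue.div (hu : ∀ x, φ x ≠ 0 → IsUnit x) {f g : K} {v w : F} (hf : HasValue ι φ f v)
    (hg : HasValue ι φ g w) (hw : w ≠ 0) : HasValue ι φ (f / g) (v / w) := by
  obtain ⟨x, rfl, rfl⟩ := hf
  obtain ⟨y, rfl, rfl⟩ := hg
  obtain ⟨y, rfl⟩ := hu y hw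
  refine ⟨x * ↑y⁻¹, ?_, ?_⟩ <;> simp [div_eq_mul_inv]

lemma HasValue.qPoch (a q : O) (k : ℕ) :
    HasValue ι φ (qPoch (ι a) (ι q) k) (qPoch (φ a) (φ q) k) := by
  rw [← map_qPoch, ← map_qPoch]
  exact .of _

lemma HasValue.qInt (q : O) (k : ℕ) : HasValue ι φ (qInt (ι q) k) (qInt (φ q) k) := by
  rw [← map_qInt, ← map_qInt]
  exact .of _

end HasValue

/-! ### Block structure at roots of unity of order d dividing n. -/

section Blocks

variable {O F K : Type*} [CommRing O] [Field F] [Field K]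
  {ι : O →+* K} {φ : O →+* F} {q : O}

lemma qInt_congr {ζ : F} {d a b : ℕ} (hζ : ζ ^ d = 1) (h1 : ζ ≠ 1) (h : a ≡ b [MOD d]) :
    qInt ζ a = qInt ζ b := by
  apply mul_left_cancel₀ (sub_ne_zero.2 h1.symm)
  rw [one_sub_mul_qInt, one_sub_mul_qInt, pow_eq_pow_of_modEq h hζ]

/-- Each block of length d has one vanishing factor above, 1 - q^(d(2a+1)), and one below, 1 -
q^(d(2a+2)). Cancelling 1 - q^d leaves q^d-integers, and the lower one has residue 2a+2 ≠ 0. -/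
lemma exists_hasValue_qPoch_div [CharZero F] {m : ℕ} (hu : ∀ x, φ x ≠ 0 → IsUnit x)
    (hζ : IsPrimitiveRoot (φ q) (2 * m + 1)) (hq : ∀ i : ℕ, 1 - ι q ^ (i + 1) ≠ 0) (a : ℕ) :
    ∃ v, HasValue ι φ (qPoch (ι q) (ι q ^ 2) (a * (2 * m + 1)) /
      qPoch (ι q ^ 2) (ι q ^ 2) (a * (2 * m + 1))) v := by
  induction a with
  | zero => exact ⟨1, 1, by simp [qPoch], by simp⟩
  | succ a ih =>
    obtain ⟨v, hv⟩ := ih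
    set d := 2 * m + 1 with hd
    have hpow : φ q ^ (2 * (a * d)) = 1 := by
      rw [← mul_assoc, mul_comm, pow_mul, hζ.pow_eq_one, one_pow]
    have hnum₁ : HasValue ι φ _ _ := .qPoch (q * (q ^ 2) ^ (a * d)) (q ^ 2) m
    have hnum₂ : HasValue ι φ _ _ :=
      .qPoch (q * (q ^ 2) ^ (a * d) * (q ^ 2) ^ (m + 1)) (q ^ 2) m
    have hden : HasValue ι φ _ _ := .qPoch (q ^ 2 * (q ^ 2) ^ (a * d)) (q ^ 2) (2 * m)
    have hi₁ : HasValue ι φ _ _ := .qInt (q ^ d) (2 * a + 1)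
    have hi₂ : HasValue ι φ _ _ := .qInt (q ^ d) (2 * a + 2)
    simp only [map_mul, map_pow, ← pow_mul (φ q) 2 (a * d), hpow, mul_one] at hden
    have hne : qInt (φ (q ^ d)) (2 * a + 2) ≠ 0 := by
      rw [map_pow, hζ.pow_eq_one]
      simp only [qInt, one_pow, Finset.sum_const, Finset.card_range, nsmul_eq_mul, mul_one]
      exact_mod_cast Nat.succ_ne_zero (2 * a + 1)
    have hfin := (hv.mul ((hnum₁.mul hnum₂).div hu hden
      (qPoch_even_ne_zero (n := d) ⟨m, rfl⟩ hζ (by omega)))).mul (hi₁.div hu hi₂ hne)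
    refine ⟨_, Eq.subst (motive := fun f => HasValue ι φ f _) ?_ hfin⟩
    simp only [map_mul, map_pow]
    have hs : 1 - ι q ^ d ≠ 0 := hq (2 * m)
    have h₁ := one_sub_mul_qInt (ι q ^ d) (2 * a + 1)
    have h₂ := one_sub_mul_qInt (ι q ^ d) (2 * a + 2)
    have e₁ : qPoch (ι q) (ι q ^ 2) ((a + 1) * d) = qPoch (ι q) (ι q ^ 2) (a * d) *
        (qPoch (ι q * (ι q ^ 2) ^ (a * d)) (ι q ^ 2) m *
          ((1 - ι q ^ d) * qInt (ι q ^ d) (2 * a + 1)) *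
          qPoch (ι q * (ι q ^ 2) ^ (a * d) * (ι q ^ 2) ^ (m + 1)) (ι q ^ 2) m) := by
      rw [show (a + 1) * d = a * d + (m + 1 + m) by rw [hd]; ring, qPoch_add,
        qPoch_add _ _ (m + 1), qPoch_succ, h₁]
      congr 4
      rw [hd]; ring
    have e₂ : qPoch (ι q ^ 2) (ι q ^ 2) ((a + 1) * d) = qPoch (ι q ^ 2) (ι q ^ 2) (a * d) *
        (qPoch (ι q ^ 2 * (ι q ^ 2) ^ (a * d)) (ι q ^ 2) (2 * m) *
          ((1 - ι q ^ d) * qInt (ι q ^ d) (2 * a + 2))) := by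
      rw [show (a + 1) * d = a * d + (2 * m + 1) by rw [hd]; ring, qPoch_add, qPoch_succ, h₂]
      congr 3
      rw [hd]; ring
    rw [e₁, e₂]
    generalize 1 - ι q ^ d = s at *
    field_simp

lemma exists_hasValue_cTerm_block [CharZero F] {m : ℕ} (hu : ∀ x, φ x ≠ 0 → IsUnit x)
    (hm : m ≠ 0) (hζ : IsPrimitiveRoot (φ q) (2 * m + 1)) (hq : ∀ i : ℕ, 1 - ι q ^ (i + 1) ≠ 0)
    (a : ℕ) : ∃ v, ∀ b < 2 * m + 1,
      HasValue ι φ (cTerm (ι q) (a * (2 * m + 1) + b)) (v * cTerm (φ q) b) := by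
  obtain ⟨w, hw⟩ := exists_hasValue_qPoch_div hu hζ hq a
  set d := 2 * m + 1 with hd
  have hpow : φ q ^ (2 * (a * d)) = 1 := by
    rw [← mul_assoc, mul_comm, pow_mul, hζ.pow_eq_one, one_pow]
  refine ⟨(-1) ^ (a * d) * w ^ 3, fun b hb => ?_⟩
  have hnum : HasValue ι φ _ _ := .qPoch (q * (q ^ 2) ^ (a * d)) (q ^ 2) b
  have hden : HasValue ι φ _ _ := .qPoch (q ^ 2 * (q ^ 2) ^ (a * d)) (q ^ 2) b
  simp only [map_mul, map_pow, ← pow_mul (φ q) 2 (a * d), hpow, mul_one] at hnum hden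
  have hpre : HasValue ι φ _ _ :=
    .of ((-1) ^ (a * d + b) * q ^ ((a * d + b) ^ 2) * qInt q (4 * (a * d + b) + 1))
  have hfin := hpre.mul ((hw.mul (hnum.div hu hden
    (qPoch_even_ne_zero (n := d) ⟨m, rfl⟩ hζ hb))).pow 3)
  convert hfin using 1
  · rw [cTerm, qPoch_add, qPoch_add, ← div_pow, mul_div_mul_comm]
    simp [map_qInt]
  · have e₁ : φ q ^ ((a * d + b) ^ 2) = φ q ^ (b ^ 2) := by
      refine pow_eq_pow_of_modEq ?_ hζ.pow_eq_one
      rw [Nat.modEq_iff_dvd]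
      exact ⟨-(a * (a * d + 2 * b)), by push_cast; ring⟩
    have e₂ : qInt (φ q) (4 * (a * d + b) + 1) = qInt (φ q) (4 * b + 1) := by
      refine qInt_congr hζ.pow_eq_one (hζ.ne_one (by omega)) ?_
      rw [Nat.modEq_iff_dvd]
      exact ⟨-(4 * a), by push_cast; ring⟩
    simp only [map_mul, map_pow, map_neg, map_one, map_qInt, e₁, e₂, cTerm, pow_add, mul_pow,
      div_pow]
    ring

/-- Complete blocks contribute nothing, so only the last partial block survives. -/
lemma sum_range_blocks {c : ℕ → F} {u : ℕ → F} {d : ℕ} (hc : ∑ b ∈ Finset.range d, c b = 0)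
    (f : ℕ → F) (hf : ∀ a, ∀ b < d, f (a * d + b) = u a * c b) (a t : ℕ) (ht : t ≤ d) :
    ∑ i ∈ Finset.range (a * d + t), f i = u a * ∑ b ∈ Finset.range t, c b := by
  have hstep (a t : ℕ) (ht : t ≤ d) :
      ∑ i ∈ Finset.range t, f (a * d + i) = u a * ∑ b ∈ Finset.range t, c b := by
    rw [Finset.mul_sum]
    exact Finset.sum_congr rfl fun b hb => hf a b ((Finset.mem_range.1 hb).trans_le ht)
  rw [Finset.sum_range_add, hstep a t ht, add_eq_right]
  induction a with
  | zero => simp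
  | succ a ih =>
    rw [add_one_mul, Finset.sum_range_add, ih, hstep a d le_rfl, hc]
    simp

/-- The convolution sum of the `cTerm`s vanishes at every primitive root of unity whose order
divides its length. -/
lemma hasValue_convolution_zero [CharZero F] {m : ℕ} (hu : ∀ x, φ x ≠ 0 → IsUnit x)
    (hm : m ≠ 0) (hζ : IsPrimitiveRoot (φ q) (2 * m + 1)) (hq : ∀ i : ℕ, 1 - ι q ^ (i + 1) ≠ 0)
    (N : ℕ) :
    HasValue ι φ (∑ i ∈ Finset.range (N * (2 * m + 1)),
      cTerm (ι q) i * ∑ j ∈ Finset.range (N * (2 * m + 1) - i), cTerm (ι q) j) 0 := by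
  choose v hv using exists_hasValue_cTerm_block hu hm hζ hq
  set d := 2 * m + 1 with hd
  have hd0 : 0 < d := by omega
  let f : ℕ → F := fun i => v (i / d) * cTerm (φ q) (i % d)
  have hf (a b : ℕ) (hb : b < d) : f (a * d + b) = v a * cTerm (φ q) b := by
    simp only [f]
    rw [mul_comm a, Nat.mul_add_div hd0, Nat.div_eq_of_lt hb, add_zero, Nat.mul_add_mod,
      Nat.mod_eq_of_lt hb]
  have hval (i : ℕ) : HasValue ι φ (cTerm (ι q) i) (f i) := by
    have := hv (i / d) (i % d) (Nat.mod_lt _ hd0)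
    rwa [Nat.div_add_mod'] at this
  have h := HasValue.sum (s := Finset.range (N * d)) fun i _ =>
    (hval i).mul (HasValue.sum (s := Finset.range (N * d - i)) fun j _ => hval j)
  convert h using 1
  refine (Finset.sum_eq_zero fun i hi => ?_).symm
  have hi' := Finset.mem_range.1 hi
  obtain ⟨a, b, hb, rfl⟩ : ∃ a b, b < d ∧ i = a * d + b :=
    ⟨i / d, i % d, Nat.mod_lt _ hd0, (Nat.div_add_mod' i d).symm⟩
  rcases lt_or_ge m b with hmb | hbm
  · rw [hf a b hb, cTerm_eq_zero hζ.pow_eq_one hmb, mul_zero, zero_mul]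
  -- Here the inner sum ends in a partial block of length d - b > m, which already contains all
  -- nonzero terms of its block and so sums to 0.
  · have haN : a < N := by
      by_contra hge
      have := Nat.mul_le_mul_right d (not_lt.1 hge)
      omega
    obtain ⟨c, rfl⟩ := Nat.exists_eq_add_of_lt haN
    rw [show (a + c + 1) * d - (a * d + b) = c * d + (d - b) by
        have : (a + c + 1) * d = a * d + c * d + d := by ring
        omega,
      sum_range_blocks (sum_cTerm_eq_zero hζ hm (by omega)) f hf c (d - b) (by omega),
      sum_cTerm_eq_zero hζ hm (by omega), mul_zero, mul_zero]

end Blocks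

/-! ### Congruences modulo powers of the prime π. -/

section LocalSupercongruence

variable {O F K : Type*} [CommRing O] [Field F] [Field K]
  {ι : O →+* K} {φ : O →+* F} {q π : O}

lemma pow_three_dvd_sum_clearedTerm_two_sub [IsDomain O] [CharZero F] {m : ℕ} (hu : ∀ x, φ x ≠ 0 → IsUnit x)
    (hι : Function.Injective ι) (hπ : ∀ x, φ x = 0 → π ∣ x) (hπ0 : π ≠ 0) (hm : m ≠ 0)
    (hζ : IsPrimitiveRoot (φ q) (2 * m + 1)) (hq : ∀ i : ℕ, 1 - ι q ^ (i + 1) ≠ 0) :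
    π ^ 3 ∣ ∑ k ∈ Finset.range (m + 1), clearedTerm q 2 m k -
      (-1) ^ m * q ^ (m ^ 2) * qInt q (2 * m + 1) *
        ∏ i ∈ Finset.range m, evenFactor q 2 i := by
  have hζ0 : φ q ≠ 0 := hζ.ne_zero (by omega)
  have hζ1 : φ q ≠ 1 := hζ.ne_one (by omega)
  obtain ⟨u, hu1⟩ := (hu q hζ0).exists_right_inv
  set n := 2 * m + 1 with hn
  set B := (-1) ^ m * q ^ (m ^ 2) * qInt q n with hB
  have hφB : φ B = 0 := by
    have : qInt (φ q) n = 0 := by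
      apply mul_left_cancel₀ (sub_ne_zero.2 hζ1.symm)
      rw [one_sub_mul_qInt, hζ.pow_eq_one, sub_self, mul_zero]
    rw [hB, map_mul, map_qInt, this, mul_zero]
  -- The deformation parameter x becomes a polynomial variable; the claim concerns P(2).
  let P : O[X] := ∑ k ∈ Finset.range (m + 1), clearedTerm (C q) X m k -
    C B * ∏ i ∈ Finset.range m, evenFactor (C q) X i
  have hP (x : O) : P.eval x = ∑ k ∈ Finset.range (m + 1), clearedTerm q x m k -
      B * ∏ i ∈ Finset.range m, evenFactor q x i := by
    rw [← coe_evalRingHom]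
    simp only [P, map_sub, map_sum, map_mul, map_prod, map_clearedTerm, map_evenFactor,
      coe_evalRingHom, eval_C, eval_X]
  have hmod : P.map φ = 0 := by
    have e : P.map φ = ∑ k ∈ Finset.range (m + 1), clearedTerm (C (φ q)) X m k := by
      rw [← coe_mapRingHom]
      simp only [P, map_sub, map_sum, map_mul, map_prod, map_clearedTerm, map_evenFactor,
        coe_mapRingHom, map_C, map_X, hφB, C_0, zero_mul, sub_zero]
    have hD : ∏ i ∈ Finset.range m, evenFactor (C (φ q)) (X : F[X]) i ≠ 0 := fun h => by
      have h' := congrArg (evalRingHom (2 : F)) h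
      simp only [map_prod, map_evenFactor, coe_evalRingHom, eval_C, eval_X, eval_zero] at h'
      rw [prod_evenFactor_two] at h'
      exact pow_ne_zero 3 (qPoch_even_ne_zero (n := n) ⟨m, rfl⟩ hζ (by omega)) h'
    -- Antisymmetry needs nonzero even factors. Multiplying by their product makes the vanishing
    -- hold at every x, and the product is then cancelled as a nonzero polynomial.
    refine (mul_eq_zero.1 (Polynomial.funext fun x => ?_ :
      P.map φ * ∏ i ∈ Finset.range m, evenFactor (C (φ q)) (X : F[X]) i = 0)).resolve_right hD
    rw [e, ← coe_evalRingHom]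
    simp only [map_sum, map_mul, map_prod, map_clearedTerm, map_evenFactor,
      coe_evalRingHom, eval_C, eval_X, eval_zero]
    by_cases hx : ∏ i ∈ Finset.range m, evenFactor (φ q) x i = 0
    · rw [hx, mul_zero]
    · rw [sum_clearedTerm_eq_zero hζ.pow_eq_one hζ1 x hx, zero_mul]
  obtain ⟨P', hP'⟩ : C π ∣ P := by
    rw [C_dvd_iff_dvd_coeff]
    intro i
    apply hπ
    rw [← coeff_map, hmod, coeff_zero]
  have hroot : P.eval (q ^ n + u ^ n) = 0 := by
    apply hι
    have hqu : ι u ^ n = (ι q ^ n)⁻¹ := by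
      apply eq_inv_of_mul_eq_one_right
      rw [← mul_pow, ← map_mul, hu1, map_one, one_pow]
    have hq0 : ι q ≠ 0 := fun h => by
      have := congrArg ι hu1
      rw [map_mul, h, zero_mul, map_one] at this
      exact zero_ne_one this
    rw [hP, map_zero, map_sub, map_sum, map_mul, map_prod, sub_eq_zero]
    simp only [map_clearedTerm, map_evenFactor, map_add, map_pow, hqu]
    rw [sum_clearedTerm_root (ι q) hq0 hq m, hB]
    simp [map_qInt, hn]
  have hroot' : P'.eval (q ^ n + u ^ n) = 0 := by
    rw [hP', eval_mul, eval_C] at hroot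
    exact (mul_eq_zero.1 hroot).resolve_left hπ0
  have hdvd := sub_dvd_eval_sub 2 (q ^ n + u ^ n) P'
  rw [hroot', sub_zero] at hdvd
  obtain ⟨w, hw⟩ : π ∣ 1 - q ^ n :=
    hπ _ (by rw [map_sub, map_one, map_pow, hζ.pow_eq_one, sub_self])
  -- 2 - q^n - q^(-n) = -q^(-n) (1 - q^n)², with u^n in the role of q^(-n).
  have hsq : π ^ 2 ∣ 2 - (q ^ n + u ^ n) := by
    have hun : q ^ n * u ^ n = 1 := by rw [← mul_pow, hu1, one_pow]
    refine ⟨-(w ^ 2 * u ^ n), ?_⟩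
    linear_combination (-(1 - q ^ n) * u ^ n - π * w * u ^ n) * hw + (q ^ n - 2) * hun
  rw [← hP, hP', eval_mul, eval_C, pow_succ']
  exact mul_dvd_mul_left _ (hsq.trans hdvd)

lemma exists_sum_cTerm_half [IsDomain O] [CharZero F] {m : ℕ} (hu : ∀ x, φ x ≠ 0 → IsUnit x)
    (hι : Function.Injective ι) (hπ : ∀ x, φ x = 0 → π ∣ x) (hπ0 : π ≠ 0) (hm : m ≠ 0)
    (hζ : IsPrimitiveRoot (φ q) (2 * m + 1)) (hq : ∀ i : ℕ, 1 - ι q ^ (i + 1) ≠ 0) :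
    ∃ z, ∑ k ∈ Finset.range (m + 1), cTerm (ι q) k =
      ι ((-1) ^ m * q ^ (m ^ 2) * qInt q (2 * m + 1) + π ^ 3 * z) := by
  obtain ⟨z, hz⟩ := pow_three_dvd_sum_clearedTerm_two_sub hu hι hπ hπ0 hm hζ hq
  have hd (k : ℕ) (hk : k ≤ m) : qPoch (ι q ^ 2) (ι q ^ 2) k ≠ 0 := by
    refine Finset.prod_ne_zero_iff.2 fun i _ => ?_
    rw [← pow_succ', ← pow_mul]
    exact hq (2 * i + 1)
  have hunit : IsUnit (qPoch (q ^ 2) (q ^ 2) m ^ 3) := hu _ <| by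
    rw [map_pow, map_qPoch, map_pow]
    exact pow_ne_zero 3 (qPoch_even_ne_zero (n := 2 * m + 1) ⟨m, rfl⟩ hζ (by omega))
  obtain ⟨v, hv⟩ := hunit.exists_right_inv
  refine ⟨z * v, ?_⟩
  have h0 : qPoch (ι q ^ 2) (ι q ^ 2) m ^ 3 ≠ 0 := pow_ne_zero 3 (hd m le_rfl)
  apply mul_right_cancel₀ h0
  rw [Finset.sum_mul, Finset.sum_congr rfl fun k hk => cTerm_mul_eq_clearedTerm (ι q)
    (Nat.lt_succ_iff.1 (Finset.mem_range.1 hk)) (hd k (Nat.lt_succ_iff.1 (Finset.mem_range.1 hk)))]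
  have e : ι (qPoch (q ^ 2) (q ^ 2) m ^ 3) = qPoch (ι q ^ 2) (ι q ^ 2) m ^ 3 := by
    rw [map_pow, map_qPoch, map_pow]
  have e' : ι (∑ k ∈ Finset.range (m + 1), clearedTerm q 2 m k) =
      ∑ k ∈ Finset.range (m + 1), clearedTerm (ι q) 2 m k := by
    simp only [map_sum, map_clearedTerm, map_ofNat]
  rw [← e, ← e', ← map_mul]
  congr 1
  rw [prod_evenFactor_two] at hz
  linear_combination hz - π ^ 3 * z * hv

lemma prod_odd_split {R : Type*} [CommRing R] (q : R) (m r : ℕ) :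
    qPoch q (q ^ 2) (m + 1 + r) = (∏ i ∈ Finset.range m, (1 - q ^ (2 * i + 1))) *
      (1 - q ^ (2 * m + 1)) *
        ∏ i ∈ Finset.range r, (1 - q ^ (2 * m + 1) * q ^ (2 * i + 2)) := by
  rw [qPoch_add, qPoch_succ]
  simp only [qPoch]
  congr 1
  · congr 1
    · exact Finset.prod_congr rfl fun i _ => by ring
    · ring
  · exact Finset.prod_congr rfl fun i _ => by ring

lemma prod_even_split {R : Type*} [CommRing R] (q : R) (m r : ℕ) :
    qPoch (q ^ 2) (q ^ 2) (m + (r + 1)) = (∏ i ∈ Finset.range m, (1 - q ^ (2 * i + 2))) *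
      ∏ i ∈ Finset.range (r + 1), (1 - q ^ (2 * m + 1) * q ^ (2 * i + 1)) := by
  rw [qPoch_add]
  simp only [qPoch]
  congr 1
  · exact Finset.prod_congr rfl fun i _ => by ring
  · exact Finset.prod_congr rfl fun i _ => by ring

/-- The numerator factorial contains 1 - q^(2m+1) once, and the denominator factorial has nonzero
residue. -/
lemma exists_hasValue_tailTerm {m r : ℕ} (hu : ∀ x, φ x ≠ 0 → IsUnit x)
    (hζ : IsPrimitiveRoot (φ q) (2 * m + 1)) (hr : r < m) :
    ∃ t, cTerm (ι q) (m + 1 + r) = ι (1 - q ^ (2 * m + 1)) ^ 3 * t ∧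
      HasValue ι φ t (tailTerm (φ q) m r) := by
  have hpre : HasValue ι φ _ _ :=
    .of ((-1) ^ (m + 1 + r) * q ^ ((m + 1 + r) ^ 2) * qInt q (4 * (m + 1 + r) + 1))
  have hnum : HasValue ι φ _ _ := .of ((∏ i ∈ Finset.range m, (1 - q ^ (2 * i + 1))) *
    ∏ i ∈ Finset.range r, (1 - q ^ (2 * m + 1) * q ^ (2 * i + 2)))
  have hden : HasValue ι φ _ _ := .of ((∏ i ∈ Finset.range m, (1 - q ^ (2 * i + 2))) *
    ∏ i ∈ Finset.range (r + 1), (1 - q ^ (2 * m + 1) * q ^ (2 * i + 1)))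
  simp only [map_mul, map_prod, map_sub, map_one, map_pow, map_neg, map_qInt, hζ.pow_eq_one,
    one_mul] at hpre hnum hden
  have hne : (∏ i ∈ Finset.range m, (1 - φ q ^ (2 * i + 2))) *
      ∏ i ∈ Finset.range (r + 1), (1 - φ q ^ (2 * i + 1)) ≠ 0 := by
    refine mul_ne_zero (Finset.prod_ne_zero_iff.2 fun i hi => ?_)
      (Finset.prod_ne_zero_iff.2 fun i hi => ?_) <;>
    · refine hζ.one_sub_pow_ne_zero fun h => ?_
      have := Finset.mem_range.1 hi
      have := Nat.le_of_dvd (by omega) h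
      omega
  refine ⟨_, ?_, hpre.mul ((hnum.div hu hden hne).pow 3)⟩
  rw [cTerm, prod_odd_split, show m + 1 + r = m + (r + 1) by ring, prod_even_split]
  simp only [map_sub, map_one, map_pow, div_eq_mul_inv, mul_pow, inv_pow]
  ring

lemma hasValue_cTerm {n k : ℕ} (hn : Odd n) (hu : ∀ x, φ x ≠ 0 → IsUnit x)
    (hζ : IsPrimitiveRoot (φ q) n) (hk : k < n) :
    HasValue ι φ (cTerm (ι q) k) (cTerm (φ q) k) := by
  have hpre : HasValue ι φ _ _ := .of ((-1) ^ k * q ^ (k ^ 2) * qInt q (4 * k + 1))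
  have hnum : HasValue ι φ _ _ := .qPoch q (q ^ 2) k
  have hden : HasValue ι φ _ _ := .qPoch (q ^ 2) (q ^ 2) k
  simp only [map_mul, map_pow, map_neg, map_one, map_qInt] at hpre hnum hden
  exact hpre.mul ((hnum.pow 3).div hu (hden.pow 3)
    (pow_ne_zero 3 (qPoch_even_ne_zero hn hζ hk)))

/-- Both indices cannot exceed m, and the two regions where exactly one does are exchanged by
symmetry. -/
lemma sum_convolution_split {R : Type*} [CommRing R] (f : ℕ → R) (m : ℕ) :
    ∑ i ∈ Finset.range (2 * m + 1), f i * ∑ j ∈ Finset.range (2 * m + 1 - i), f j =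
      (∑ i ∈ Finset.range (m + 1), f i) ^ 2 +
        2 * ∑ r ∈ Finset.range m, f (m + 1 + r) * ∑ j ∈ Finset.range (m - r), f j := by
  have h₁ (i : ℕ) (hi : i ∈ Finset.range (m + 1)) :
      f i * ∑ j ∈ Finset.range (2 * m + 1 - i), f j =
        f i * ∑ j ∈ Finset.range (m + 1), f j +
          ∑ r ∈ Finset.range (m - i), f i * f (m + 1 + r) := by
    have := Finset.mem_range.1 hi
    rw [show 2 * m + 1 - i = m + 1 + (m - i) by omega, Finset.sum_range_add, mul_add,
      Finset.mul_sum (Finset.range (m - i))]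
  have h₂ : ∑ i ∈ Finset.range (m + 1), ∑ r ∈ Finset.range (m - i), f i * f (m + 1 + r) =
      ∑ r ∈ Finset.range m, f (m + 1 + r) * ∑ j ∈ Finset.range (m - r), f j := by
    simp only [Finset.mul_sum]
    refine (Finset.sum_comm' fun i r => ?_).trans
      (Finset.sum_congr rfl fun r _ => Finset.sum_congr rfl fun i _ => mul_comm _ _)
    simp only [Finset.mem_range]
    omega
  have h₃ (r : ℕ) : 2 * m + 1 - (m + 1 + r) = m - r := by omega
  have h₄ := Finset.sum_range_add
    (fun i => f i * ∑ j ∈ Finset.range (2 * m + 1 - i), f j) (m + 1) m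
  rw [show m + 1 + m = 2 * m + 1 by ring, Finset.sum_congr rfl h₁, Finset.sum_add_distrib, h₂,
    ← Finset.sum_mul] at h₄
  simp only [h₃] at h₄
  rw [h₄]
  ring

/-- The convolution sum of the `cTerm`s modulo the fourth power of a cyclotomic prime. -/
lemma exists_convolution_sub_eq [IsDomain O] [CharZero F] {m : ℕ} (hu : ∀ x, φ x ≠ 0 → IsUnit x)
    (hι : Function.Injective ι) (hπ : ∀ x, φ x = 0 → π ∣ x) (hπ0 : π ≠ 0) (hm : m ≠ 0)
    (hζ : IsPrimitiveRoot (φ q) (2 * m + 1)) (hq : ∀ i : ℕ, 1 - ι q ^ (i + 1) ≠ 0) :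
    ∃ z, ∑ i ∈ Finset.range (2 * m + 1),
        cTerm (ι q) i * ∑ j ∈ Finset.range (2 * m + 1 - i), cTerm (ι q) j -
      ι q ^ (2 * m ^ 2) * qInt (ι q) (2 * m + 1) ^ 2 = ι (π ^ 4 * z) := by
  obtain ⟨z, hz⟩ := exists_sum_cTerm_half hu hι hπ hπ0 hm hζ hq
  obtain ⟨w, hw⟩ : π ∣ 1 - q ^ (2 * m + 1) :=
    hπ _ (by rw [map_sub, map_one, map_pow, hζ.pow_eq_one, sub_self])
  obtain ⟨b, hb⟩ : π ∣ qInt q (2 * m + 1) := hπ _ <| by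
    rw [map_qInt]
    apply mul_left_cancel₀ (sub_ne_zero.2 (hζ.ne_one (by omega)).symm)
    rw [one_sub_mul_qInt, hζ.pow_eq_one, sub_self, mul_zero]
  have ht (r : ℕ) : ∃ t, r < m → cTerm (ι q) (m + 1 + r) = ι (1 - q ^ (2 * m + 1)) ^ 3 * t ∧
      HasValue ι φ t (tailTerm (φ q) m r) := by
    by_cases hr : r < m
    · obtain ⟨t, ht⟩ := exists_hasValue_tailTerm (ι := ι) hu hζ hr
      exact ⟨t, fun _ => ht⟩
    -- An arbitrary value outside the range, so that t can be chosen for all r.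
    · exact ⟨0, fun h => absurd h hr⟩
  choose t ht using ht
  have htail : HasValue ι φ (∑ r ∈ Finset.range m,
      t r * ∑ j ∈ Finset.range (m - r), cTerm (ι q) j) 0 := by
    rw [← sum_tailTerm_mul_eq_zero hζ]
    refine HasValue.sum fun r hr => (ht r (Finset.mem_range.1 hr)).2.mul
      (HasValue.sum fun j hj => hasValue_cTerm ⟨m, rfl⟩ hu hζ ?_)
    have := Finset.mem_range.1 hj
    omega
  obtain ⟨y, hy, hy0⟩ := htail
  obtain ⟨y, rfl⟩ := hπ y hy0
  have htail' : ∑ r ∈ Finset.range m,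
      cTerm (ι q) (m + 1 + r) * ∑ j ∈ Finset.range (m - r), cTerm (ι q) j =
        ι ((π * w) ^ 3 * (π * y)) := by
    rw [map_mul, hy, ← hw, map_pow, Finset.mul_sum]
    refine Finset.sum_congr rfl fun r hr => ?_
    rw [(ht r (Finset.mem_range.1 hr)).1, mul_assoc]
  -- The cross term and the square of π³z from the half sum, then the doubled tail, each divided by
  -- π⁴.
  refine ⟨2 * ((-1) ^ m * q ^ (m ^ 2) * b) * z + π ^ 2 * z ^ 2 + 2 * w ^ 3 * y, ?_⟩
  have hS : ι q ^ (2 * m ^ 2) * qInt (ι q) (2 * m + 1) ^ 2 =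
      ι (q ^ (2 * m ^ 2) * qInt q (2 * m + 1) ^ 2) := by simp [map_qInt]
  rw [sum_convolution_split, hz, htail', hS, hb, ← map_ofNat ι 2, ← map_pow, ← map_mul, ← map_add,
    ← map_sub]
  congr 1
  have hsgn : ((-1 : O) ^ m) ^ 2 = 1 := by rw [← pow_mul, Even.neg_one_pow ⟨m, by ring⟩]
  rw [pow_mul' q 2]
  linear_combination (q ^ m ^ 2) ^ 2 * (π * b) ^ 2 * hsgn

end LocalSupercongruence

/-! ### Rational functions regular at ζ, and return to numerators. -/

section LocalRingAtRootOfUnity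

/-- The rational functions that are regular at `ζ`, with their embedding into `ℚ(X)` and their
evaluation at `ζ`. -/
lemma exists_regular_functions_ring (ζ : ℂ) :
    ∃ (O : Type) (_ : CommRing O) (_ : IsDomain O) (ι : O →+* RatFunc ℚ) (φ : O →+* ℂ)
      (j : ℚ[X] →+* O), Function.Injective ι ∧ (∀ x, φ x ≠ 0 → IsUnit x) ∧
        (∀ p, ι (j p) = algebraMap ℚ[X] (RatFunc ℚ) p) ∧ (∀ p, φ (j p) = aeval ζ p) ∧
        ∀ x, ∃ p s, aeval ζ s ≠ 0 ∧ x * j s = j p := by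
  let M : Submonoid ℚ[X] := (nonZeroDivisors ℂ).comap (aeval ζ : ℚ[X] →ₐ[ℚ] ℂ)
  have hM (s : ℚ[X]) : s ∈ M ↔ aeval ζ s ≠ 0 := by
    simp [M, Submonoid.mem_comap, mem_nonZeroDivisors_iff_ne_zero]
  have hM0 (s : ℚ[X]) (hs : s ∈ M) : s ≠ 0 := fun h => (hM s).1 hs (by rw [h, map_zero])
  have hle : M ≤ nonZeroDivisors ℚ[X] := fun s hs => mem_nonZeroDivisors_iff_ne_zero.2 (hM0 s hs)
  have hι (y : M) : IsUnit (algebraMap ℚ[X] (RatFunc ℚ) y) :=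
    (RatFunc.algebraMap_ne_zero (hM0 y y.2)).isUnit
  have hφ (y : M) : IsUnit ((aeval ζ : ℚ[X] →ₐ[ℚ] ℂ).toRingHom y) :=
    ((hM y).1 y.2).isUnit
  have hdom : IsDomain (Localization M) := IsLocalization.isDomain_localization hle
  refine ⟨Localization M, inferInstance, hdom, IsLocalization.lift hι, IsLocalization.lift hφ,
    algebraMap _ _, ?_, ?_, fun p => IsLocalization.lift_eq hι p,
    fun p => IsLocalization.lift_eq hφ p, ?_⟩
  · rw [IsLocalization.lift_injective_iff]
    intro x y
    rw [(IsLocalization.injective (Localization M) hle).eq_iff,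
      (RatFunc.algebraMap_injective ℚ).eq_iff]
  · intro x hx
    obtain ⟨p, s, rfl⟩ := IsLocalization.exists_mk'_eq M x
    rw [IsLocalization.lift_mk'] at hx
    have hp : p ∈ M := (hM p).2 fun h => hx <| by
      rw [show (aeval ζ : ℚ[X] →ₐ[ℚ] ℂ).toRingHom p = 0 from h, zero_mul]
    rw [← mul_one p, ← IsLocalization.mul_mk'_eq_mk'_of_mul]
    refine (IsLocalization.map_units _ (⟨p, hp⟩ : M)).mul ?_
    refine IsUnit.of_mul_eq_one (algebraMap _ _ (s : ℚ[X])) ?_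
    rw [IsLocalization.mk'_spec, map_one]
  · intro x
    obtain ⟨p, s, rfl⟩ := IsLocalization.exists_mk'_eq M x
    exact ⟨p, s, (hM s).1 s.2, IsLocalization.mk'_spec _ _ _⟩

variable {ζ : ℂ} {n : ℕ}

lemma cyclotomic_dvd_iff_aeval_eq_zero (hζ : IsPrimitiveRoot ζ n) (hn : 0 < n) (p : ℚ[X]) :
    cyclotomic n ℚ ∣ p ↔ aeval ζ p = 0 := by
  rw [cyclotomic_eq_minpoly_rat hζ hn, minpoly.dvd_iff]

/-- Φ_n is irreducible and s does not vanish at ζ, so s is coprime to Φ_n and cannot absorb any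
power of it. -/
lemma cyclotomic_pow_dvd_num (hζ : IsPrimitiveRoot ζ n) (hn : 0 < n) {f : RatFunc ℚ}
    {p s : ℚ[X]} {k : ℕ} (hs : aeval ζ s ≠ 0)
    (h : f * algebraMap _ _ s = algebraMap ℚ[X] (RatFunc ℚ) (cyclotomic n ℚ ^ k * p)) :
    cyclotomic n ℚ ^ k ∣ f.num := by
  have hs0 : s ≠ 0 := fun h => hs (by rw [h, map_zero])
  rw [← eq_div_iff (RatFunc.algebraMap_ne_zero hs0), ← RatFunc.num_mul_eq_mul_denom_iff hs0] at h
  have hc : IsCoprime (cyclotomic n ℚ) s :=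
    ((cyclotomic.irreducible_rat hn).coprime_iff_not_dvd).2 fun hd =>
      hs ((cyclotomic_dvd_iff_aeval_eq_zero hζ hn s).1 hd)
  exact hc.pow_left.dvd_of_dvd_mul_right (h ▸ Dvd.intro _ (mul_assoc _ p f.denom).symm)

lemma one_sub_ratFuncX_pow_ne_zero (i : ℕ) : 1 - (RatFunc.X : RatFunc ℚ) ^ (i + 1) ≠ 0 := by
  rw [← RatFunc.algebraMap_X, ← map_pow, ← map_one (algebraMap ℚ[X] (RatFunc ℚ)), ← map_sub]
  refine RatFunc.algebraMap_ne_zero fun h => ?_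
  have := congrArg (eval (0 : ℚ)) h
  simp at this

end LocalRingAtRootOfUnity

/-! ### Assembly over the divisors of n. -/

lemma qInt_X_eq_prod {n : ℕ} (hn : 0 < n) :
    qInt (X : ℚ[X]) n = ∏ i ∈ n.divisors.erase 1, cyclotomic i ℚ :=
  (prod_cyclotomic_eq_geom_sum hn ℚ).symm

lemma two_mul_sq_half (m : ℕ) : (2 * m + 1 - 1) ^ 2 / 2 = 2 * m ^ 2 := by
  rw [Nat.add_sub_cancel]
  apply Nat.div_eq_of_eq_mul_right two_pos
  ring

/-- The difference of the two sides of the supercongruence. -/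
noncomputable def convolutionDefect (n : ℕ) : RatFunc ℚ :=
  ∑ i ∈ Finset.range n, cTerm (RatFunc.X : RatFunc ℚ) i *
      ∑ j ∈ Finset.range (n - i), cTerm (RatFunc.X : RatFunc ℚ) j -
    (RatFunc.X : RatFunc ℚ) ^ ((n - 1) ^ 2 / 2) * qInt (RatFunc.X : RatFunc ℚ) n ^ 2

lemma cyclotomic_pow_four_dvd {n : ℕ} (hn : Odd n) (hn1 : n ≠ 1) :
    cyclotomic n ℚ ^ 4 ∣ (convolutionDefect n).num := by
  obtain ⟨m, rfl⟩ := hn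
  have hn0 : 0 < 2 * m + 1 := by omega
  have hζ := Complex.isPrimitiveRoot_exp (2 * m + 1) hn0.ne'
  set ζ := Complex.exp (2 * Real.pi * Complex.I / (2 * m + 1 : ℕ))
  obtain ⟨O, _, _, ι, φ, j, hι, hu, hιj, hφj, hfrac⟩ := exists_regular_functions_ring ζ
  have hιX : ι (j X) = RatFunc.X := by rw [hιj, RatFunc.algebraMap_X]
  have hφX : φ (j X) = ζ := by rw [hφj, aeval_X]
  have hπ (x : O) (hx : φ x = 0) : j (cyclotomic (2 * m + 1) ℚ) ∣ x := by
    obtain ⟨p, s, hs, h⟩ := hfrac x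
    have hp : aeval ζ p = 0 := by rw [← hφj, ← h, map_mul, hx, zero_mul]
    obtain ⟨r, rfl⟩ := (cyclotomic_dvd_iff_aeval_eq_zero hζ hn0 p).2 hp
    have hsu : IsUnit (j s) := hu _ (by rwa [hφj])
    rw [← hsu.dvd_mul_right, h, map_mul]
    exact dvd_mul_right _ _
  have hπ0 : j (cyclotomic (2 * m + 1) ℚ) ≠ 0 := fun h => by
    have := hιj (cyclotomic (2 * m + 1) ℚ)
    rw [h, map_zero] at this
    exact RatFunc.algebraMap_ne_zero (cyclotomic_ne_zero _ _) this.symm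
  obtain ⟨z, hz⟩ := exists_convolution_sub_eq hu hι hπ hπ0 (show m ≠ 0 by omega) (by rwa [hφX])
    (fun i => by rw [hιX]; exact one_sub_ratFuncX_pow_ne_zero i)
  obtain ⟨p, s, hs, h⟩ := hfrac z
  rw [hιX] at hz
  refine cyclotomic_pow_dvd_num hζ hn0 (p := p) hs ?_
  rw [convolutionDefect, two_mul_sq_half, hz, ← hιj, ← map_mul, mul_assoc, h]
  simp only [map_mul, map_pow, hιj]

lemma cyclotomic_dvd_of_dvd {d n : ℕ} (hn : Odd n) (hd : d ∣ n) (hd1 : d ≠ 1) :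
    cyclotomic d ℚ ∣ (convolutionDefect n).num := by
  obtain ⟨N, rfl⟩ := hd
  obtain ⟨m, rfl⟩ := (Nat.odd_mul.1 hn).1
  have hd0 : 0 < 2 * m + 1 := by omega
  have hζ := Complex.isPrimitiveRoot_exp (2 * m + 1) hd0.ne'
  set ζ := Complex.exp (2 * Real.pi * Complex.I / (2 * m + 1 : ℕ))
  obtain ⟨O, _, _, ι, φ, j, hι, hu, hιj, hφj, hfrac⟩ := exists_regular_functions_ring ζ
  have hιX : ι (j X) = RatFunc.X := by rw [hιj, RatFunc.algebraMap_X]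
  have hφX : φ (j X) = ζ := by rw [hφj, aeval_X]
  obtain ⟨x, hx, hx0⟩ := hasValue_convolution_zero hu (show m ≠ 0 by omega) (by rwa [hφX])
    (fun i => by rw [hιX]; exact one_sub_ratFuncX_pow_ne_zero i) N
  -- The comparison term vanishes at ζ as well, because the order of ζ divides n and so [n] is 0
  -- there.
  have hval : φ (x - j (X ^ (((2 * m + 1) * N - 1) ^ 2 / 2) * qInt X ((2 * m + 1) * N) ^ 2)) =
      0 := by
    have h0 : qInt ζ ((2 * m + 1) * N) = 0 := by
      apply mul_left_cancel₀ (sub_ne_zero.2 (hζ.ne_one (by omega)).symm)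
      rw [one_sub_mul_qInt, pow_mul, hζ.pow_eq_one, one_pow, sub_self, mul_zero]
    have h1 : φ (j (qInt X ((2 * m + 1) * N))) = 0 := by
      rw [map_qInt, map_qInt, hφX, h0]
    rw [map_sub, hx0, map_mul, map_mul, map_pow j (qInt _ _), map_pow φ (j (qInt _ _)), h1]
    ring
  obtain ⟨p, s, hs, h⟩ := hfrac
    (x - j (X ^ (((2 * m + 1) * N - 1) ^ 2 / 2) * qInt X ((2 * m + 1) * N) ^ 2))
  have hp : aeval ζ p = 0 := by rw [← hφj, ← h, map_mul, hval, zero_mul]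
  obtain ⟨r, rfl⟩ := (cyclotomic_dvd_iff_aeval_eq_zero hζ hd0 p).2 hp
  rw [← pow_one (cyclotomic _ ℚ)]
  refine cyclotomic_pow_dvd_num hζ hd0 (p := r) hs ?_
  rw [pow_one, ← hιj, ← hιj, ← h, map_mul, map_sub, hx, hιX, convolutionDefect, map_mul, map_mul]
  simp only [map_pow, map_qInt, hιX, mul_comm N]

theorem theorem3 (n : ℕ) (hn : Odd n) :
    QCongr (qInt (X : ℚ[X]) n * cyclotomic n ℚ ^ 3)
      (∑ k ∈ Finset.range n, ∑ j ∈ Finset.range (k + 1),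
        cTerm (RatFunc.X : RatFunc ℚ) j * cTerm (RatFunc.X : RatFunc ℚ) (k - j))
      ((RatFunc.X : RatFunc ℚ) ^ ((n - 1) ^ 2 / 2) * qInt (RatFunc.X : RatFunc ℚ) n ^ 2) := by
  have hdefect : (∑ k ∈ Finset.range n, ∑ j ∈ Finset.range (k + 1),
        cTerm (RatFunc.X : RatFunc ℚ) j * cTerm (RatFunc.X : RatFunc ℚ) (k - j)) -
      ((RatFunc.X : RatFunc ℚ) ^ ((n - 1) ^ 2 / 2) * qInt (RatFunc.X : RatFunc ℚ) n ^ 2) =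
      convolutionDefect n := by
    rw [Finset.sum_range_diag_flip n fun i j =>
      cTerm (RatFunc.X : RatFunc ℚ) i * cTerm (RatFunc.X : RatFunc ℚ) j, convolutionDefect]
    simp only [Finset.mul_sum]
  rw [QCongr, hdefect]
  rcases eq_or_ne n 1 with rfl | hn1
  -- For n = 1 the defect is 0, so divisibility by Φ_1^3 is trivial.
  · simp [convolutionDefect, cTerm, qPoch, qInt]
  have hn0 : n ≠ 0 := by rintro rfl; simp at hn
  have hmem : n ∈ n.divisors.erase 1 := Finset.mem_erase.2 ⟨hn1, Nat.mem_divisors_self n hn0⟩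
  -- The factor Φ_n of [n] joins Φ_n^3, leaving Φ_n^4 times the other Φ_d.
  rw [qInt_X_eq_prod (Nat.pos_of_ne_zero hn0), ← Finset.prod_erase_mul _ _ hmem, mul_assoc,
    ← pow_succ']
  refine IsCoprime.mul_dvd ?_ ?_ (cyclotomic_pow_four_dvd hn hn1)
  · exact IsCoprime.prod_left fun d hd =>
      (cyclotomic.isCoprime_rat (Finset.ne_of_mem_erase hd)).pow_right
  · refine Finset.prod_dvd_of_coprime (fun a _ b _ hab => cyclotomic.isCoprime_rat hab)
      fun d hd => ?_
    have hd' := Finset.mem_erase.1 (Finset.mem_of_mem_erase hd)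
    exact cyclotomic_dvd_of_dvd hn (Nat.dvd_of_mem_divisors hd'.2) hd'.1
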